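/- Structures are allowed to be empty. Let $T$ be a universal theory in a finite relational language $\mathscr L$ (no function or constant symbols) containing a binary relation symbol $R$. Suppose that $T$ asserts that $R$ is transitive, and that the class of models of $T$ has the superamalgamation property with respect to $R$: whenever $\mathbf A,\mathbf B,\mathbf C$ are models of $T$ with $\mathbf C\subseteq\mathbf A$, $\mathbf C\subseteq\mathbf B$ and $C=A\cap B$, there is a model $\mathbf D$ of $T$ with $\mathbf A\subseteq\mathbf D$ and $\mathbf B\subseteq\mathbf D$ such that, for all $a\in A\setminus B$ and $b\in B\setminus A$, if $a\mathrel{R_{\mathbf D}}b$ then there is $c\in C$ with $a\mathrel{R_{\mathbf A}}c$ and $c\mathrel{R_{\mathbf B}}b$, and if $b\mathrel{R_{\mathbf D}}a$ then there is $c\in C$ with $b\mathrel{R_{\mathbf B}}c$ and $c\mathrel{R_{\mathbf A}}a$. Let $K_1,\dots,K_k$ ($k\ge 0$) be new unary operation symbols, and for each $i$ choose one of the following requirements on $K_i$: idempotent ($K_iK_ix=K_ix$); idempotent and isotone ($x\mathrel R y$ implies $K_ix\mathrel R K_iy$); idempotent and extensive ($x\mathrel R K_ix$); a closure operation (idempotent,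 isotone and extensive). Let $T_1$ be the theory in the language $\mathscr L\cup\{K_1,\dots,K_k\}$ obtained from $T$ by adding, for each $i$, axioms expressing the requirement chosen for $K_i$, and, for all $i,j$, the axiom $K_iK_jx=K_jK_ix$. Then $T_1$ has a model completion; that is, $T_1$ has the amalgamation property, and there is a theory $T^*$ in the language of $T_1$ which is model complete (every embedding between models of $T^*$ is elementary) and has the same universal consequences as $T_1$. -/

import Mathlib

open FirstOrder

universe u v w

namespace FirstOrder.Language

section Amalgamation

variable {L : Language.{u, v}}

/-- The class of all models of `T` with universe in `Type w`. As usual for amalgamation,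
the empty structure counts as a structure. -/
def Theory.models (T : L.Theory) : Set (CategoryTheory.Bundled.{w} L.Structure) :=
  {M | M ⊨ T}

/-- `T ⊨ φ`, where the empty structure (if it is a model of `T`) is taken into account. -/
def Theory.Entails (T : L.Theory) (φ : L.Sentence) : Prop :=
  ∀ M ∈ Theory.models.{u, v, w} T, M ⊨ φ

/-- The superamalgamation property with respect to the binary relation symbol `R`, for a class `K`
of structures closed under isomorphism. The structures `C ⊆ A`, `C ⊆ B` with `C = A ∩ B` are given
up to isomorphism by two embeddings `f : C → A` and `g : C → B`; the amalgam `D ⊇ A, B` is given by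
two embeddings `i : A → D` and `j : B → D` which agree on `C` and whose ranges only intersect in the
image of `C`. -/
def Superamalgamation (K : Set (CategoryTheory.Bundled.{w} L.Structure))
    (R : L.Relations 2) : Prop :=
  ∀ (A B C : CategoryTheory.Bundled.{w} L.Structure) (f : C ↪[L] A) (g : C ↪[L] B),
    A ∈ K → B ∈ K → C ∈ K →
    ∃ (D : CategoryTheory.Bundled.{w} L.Structure) (i : A ↪[L] D) (j : B ↪[L] D),
      D ∈ K ∧
      (∀ c : C, i (f c) = j (g c)) ∧
      (∀ (a : A) (b : B), i a = j b → ∃ c : C, f c = a ∧ g c = b) ∧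
      ∀ (a : A) (b : B), a ∉ Set.range f → b ∉ Set.range g →
        (Structure.RelMap R ![i a, j b] →
          ∃ c : C, Structure.RelMap R ![a, f c] ∧ Structure.RelMap R ![g c, b]) ∧
        (Structure.RelMap R ![j b, i a] →
          ∃ c : C, Structure.RelMap R ![b, g c] ∧ Structure.RelMap R ![f c, a])

/-- A theory is model complete if every embedding between models of it is elementary. -/
def Theory.IsModelComplete (T : L.Theory) : Prop :=
  ∀ M ∈ Theory.models.{u, v, w} T, ∀ N ∈ Theory.models.{u, v, w} T,
    ∀ f : M ↪[L] N, ∃ g : M ↪ₑ[L] N, g.toEmbedding = f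

/-- `T'` is a model companion of `T`: it is model complete, and has the same universal
consequences as `T`. -/
def Theory.IsModelCompanion (T T' : L.Theory) : Prop :=
  Theory.IsModelComplete.{u, v, w} T' ∧
    ∀ φ : L.Sentence, BoundedFormula.IsUniversal φ →
      (Theory.Entails.{u, v, w} T φ ↔ Theory.Entails.{u, v, w} T' φ)

/-- `T'` is a model completion of `T`: it is a model companion of `T`, and `T` has the
amalgamation property. -/
def Theory.IsModelCompletion (T T' : L.Theory) : Prop :=
  Theory.IsModelCompanion.{u, v, w} T T' ∧ Amalgamation (Theory.models.{u, v, w} T)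

end Amalgamation

section Operations

/-- The function symbols `K₀, …, Kₖ₋₁`, all of them unary. -/
inductive OpFunctions (k : ℕ) : ℕ → Type
  | op (i : Fin k) : OpFunctions k 1

/-- The language whose only symbols are `k` unary function symbols. -/
def opLanguage (k : ℕ) : Language.{0, 0} where
  Functions := OpFunctions k
  Relations := fun _ => Empty

/-- The requirements that may be imposed on a new unary operation. -/
inductive OpKind : Type
  | idempotent
  | idempotentIsotone
  | idempotentExtensive
  | closure

variable (L : Language.{u, v})

/-- The language `L ∪ {K₀, …, Kₖ₋₁}`. -/
abbrev addOps (k : ℕ) : Language.{u, v} := L.sum (opLanguage k)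

variable {L} {k : ℕ}

/-- The function symbol `Kᵢ` of the extended language. -/
def opSymbol (L : Language.{u, v}) (i : Fin k) : (L.addOps k).Functions 1 :=
  Sum.inr (OpFunctions.op i)

/-- The term `Kᵢ t`. -/
def opTerm (i : Fin k) {n : ℕ} (t : (L.addOps k).Term (Empty ⊕ Fin n)) :
    (L.addOps k).Term (Empty ⊕ Fin n) :=
  (opSymbol L i).apply₁ t

/-- `R`, as a relation symbol of the extended language. -/
def liftRel (k : ℕ) (R : L.Relations 2) : (L.addOps k).Relations 2 :=
  (LHom.sumInl : L →ᴸ L.addOps k).onRelation R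

/-- `∀ x, Kᵢ Kᵢ x = Kᵢ x`. -/
def idempotentAxiom (L : Language.{u, v}) (i : Fin k) : (L.addOps k).Sentence :=
  ∀' (opTerm i (opTerm i (&0)) =' opTerm i (&0))

/-- `∀ x y, x R y → Kᵢ x R Kᵢ y`. -/
def isotoneAxiom (R : L.Relations 2) (i : Fin k) : (L.addOps k).Sentence :=
  ∀' ∀' ((liftRel k R).boundedFormula₂ (&0) (&1) ⟹
    (liftRel k R).boundedFormula₂ (opTerm i (&0)) (opTerm i (&1)))

/-- `∀ x, x R Kᵢ x`. -/
def extensiveAxiom (R : L.Relations 2) (i : Fin k) : (L.addOps k).Sentence :=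
  ∀' ((liftRel k R).boundedFormula₂ (&0) (opTerm i (&0)))

/-- `∀ x, Kᵢ Kⱼ x = Kⱼ Kᵢ x`. -/
def commuteAxiom (L : Language.{u, v}) (i j : Fin k) : (L.addOps k).Sentence :=
  ∀' (opTerm i (opTerm j (&0)) =' opTerm j (opTerm i (&0)))

/-- The axioms which say that `Kᵢ` satisfies the given requirements (with respect to `R`). -/
def OpKind.axioms (R : L.Relations 2) (i : Fin k) : OpKind → (L.addOps k).Theory
  | idempotent => {idempotentAxiom L i}
  | idempotentIsotone => {idempotentAxiom L i, isotoneAxiom R i}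
  | idempotentExtensive => {idempotentAxiom L i, extensiveAxiom R i}
  | closure => {idempotentAxiom L i, isotoneAxiom R i, extensiveAxiom R i}

/-- The extension of `T` by `k` pairwise commuting unary operations, where the `i`-th operation
satisfies the requirements given by `kind i`. -/
def Theory.expand (T : L.Theory) (R : L.Relations 2) (kind : Fin k → OpKind) :
    (L.addOps k).Theory :=
  (LHom.sumInl : L →ᴸ L.addOps k).onTheory T ∪
    (⋃ i, (kind i).axioms R i) ∪
    {φ | ∃ i j : Fin k, φ = commuteAxiom L i j}

end Operations

end FirstOrder.Language

namespace FirstOrder.Language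

/-! ### Atomic types and generated substructures -/

section AtomicType

variable {L : Language.{u, v}} {n : ℕ}

/-- Two tuples (in possibly different structures) satisfy the same atomic formulas. -/
def SameAtomic (L : Language.{u, v}) {M N : Type*} [L.Structure M] [L.Structure N] {n : ℕ}
    (a : Fin n → M) (b : Fin n → N) : Prop :=
  ∀ φ : L.BoundedFormula Empty n, φ.IsAtomic → (φ.Realize default a ↔ φ.Realize default b)

variable {M N P : Type*} [L.Structure M] [L.Structure N] [L.Structure P]

theorem SameAtomic.symm {a : Fin n → M} {b : Fin n → N} (h : SameAtomic L a b) :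
    SameAtomic L b a :=
  fun φ hφ => (h φ hφ).symm

theorem SameAtomic.trans {a : Fin n → M} {b : Fin n → N} {c : Fin n → P}
    (h : SameAtomic L a b) (h' : SameAtomic L b c) : SameAtomic L a c :=
  fun φ hφ => (h φ hφ).trans (h' φ hφ)

theorem SameAtomic.of_embedding (f : M ↪[L] N) (a : Fin n → M) : SameAtomic L (f ∘ a) a := by
  intro φ hφ
  rw [← hφ.isQF.realize_embedding f, Subsingleton.elim (f ∘ default) default]

theorem SameAtomic.realize_term_eq {a : Fin n → M} {b : Fin n → N} (h : SameAtomic L a b)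
    (t s : L.Term (Fin n)) : t.realize a = s.realize a ↔ t.realize b = s.realize b := by
  have := h ((t.relabel Sum.inr).bdEqual (s.relabel Sum.inr)) (.equal _ _)
  simpa using this

theorem SameAtomic.relMap_iff {a : Fin n → M} {b : Fin n → N} (h : SameAtomic L a b)
    {m : ℕ} (r : L.Relations m) (t : Fin m → L.Term (Fin n)) :
    Structure.RelMap r (fun i => (t i).realize a) ↔
      Structure.RelMap r (fun i => (t i).realize b) := by
  have := h (r.boundedFormula fun i => (t i).relabel Sum.inr) (.rel _ _)
  simpa using this

theorem exists_term_of_mem_closure_range {b : Fin n → N} {x : N}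
    (hx : x ∈ Substructure.closure L (Set.range b)) : ∃ t : L.Term (Fin n), t.realize b = x := by
  obtain ⟨t, rfl⟩ := Substructure.mem_closure_iff_exists_term.1 hx
  choose g hg using fun y : Set.range b => y.2
  exact ⟨t.relabel g, by simp [Function.comp_def, hg]⟩

/-- Tuples which satisfy the same atomic formulas generate isomorphic substructures. -/
theorem SameAtomic.exists_embedding {a : Fin n → M} {b : Fin n → N} (h : SameAtomic L a b) :
    ∃ f : Substructure.closure L (Set.range b) ↪[L] M,
      ∀ (i : Fin n) (hi : b i ∈ Substructure.closure L (Set.range b)), f ⟨b i, hi⟩ = a i := by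
  -- Each element is sent to the value at `a` of a term naming it. The choice of term is immaterial,
  -- since equalities between terms are atomic.
  choose t ht using fun x : Substructure.closure L (Set.range b) =>
    exists_term_of_mem_closure_range x.2
  refine ⟨⟨⟨fun x => (t x).realize a, fun x y hxy => ?_⟩, fun {m} F x => ?_, fun {m} r x => ?_⟩,
    fun i hi => ?_⟩
  · exact Subtype.ext (by rw [← ht, ← ht]; exact (h.realize_term_eq _ _).1 hxy)
  · change _ = (Term.func F fun i => t (x i)).realize a
    refine (h.realize_term_eq _ _).2 ?_
    simp only [ht, Term.realize_func]
    rfl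
  · change Structure.RelMap r (fun i => (t (x i)).realize a) ↔ _
    rw [h.relMap_iff]
    simp only [ht]
    rfl
  · exact (h.realize_term_eq _ (Term.var i)).2 (ht _)

end AtomicType

/-! ### Rich models and back-and-forth -/

section Rich

variable {L : Language.{u, v}}

/-- `M` realizes every one-point extension of atomic types of tuples of `M` which is realized in
some model of `T`. -/
def IsRich (T : L.Theory) (M : Type*) [L.Structure M] : Prop :=
  ∀ N ∈ Theory.models.{u, v, w} T, ∀ (n : ℕ) (a : Fin n → M) (b : Fin n → N) (z : N),
    SameAtomic L a b → ∃ y : M, SameAtomic L (Fin.snoc a y : Fin (n + 1) → M)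
      (Fin.snoc b z : Fin (n + 1) → N)

/-- Back-and-forth, by induction on the formula: at a quantifier, richness of either model answers
an element chosen in the other, which is itself a model of `T`. -/
theorem IsRich.realize_iff {T : L.Theory} {M N : CategoryTheory.Bundled.{w} L.Structure}
    (hMT : M ∈ Theory.models T) (hNT : N ∈ Theory.models T)
    (hM : IsRich.{u, v, w} T M) (hN : IsRich.{u, v, w} T N) {n : ℕ}
    (φ : L.BoundedFormula Empty n) {a : Fin n → M} {b : Fin n → N} (h : SameAtomic L a b) :
    φ.Realize default a ↔ φ.Realize default b := by
  induction φ with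
  | falsum => rfl
  | equal t s => exact h _ (.equal t s)
  | rel r t => exact h _ (.rel r t)
  | imp _ _ ih₁ ih₂ => simp only [BoundedFormula.realize_imp, ih₁ h, ih₂ h]
  | all φ ih =>
    simp only [BoundedFormula.realize_all]
    refine ⟨fun H z => ?_, fun H z => ?_⟩
    · obtain ⟨y, hy⟩ := hM N hNT _ a b z h
      exact (ih hy).1 (H y)
    · obtain ⟨y, hy⟩ := hN M hMT _ b a z h.symm
      exact (ih hy.symm).2 (H y)

/-- Every embedding between rich models is elementary. -/
theorem IsRich.exists_elementaryEmbedding {T : L.Theory}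
    {M N : CategoryTheory.Bundled.{w} L.Structure}
    (hMT : M ∈ Theory.models T) (hNT : N ∈ Theory.models T)
    (hM : IsRich.{u, v, w} T M) (hN : IsRich.{u, v, w} T N) (f : M ↪[L] N) :
    ∃ g : M ↪ₑ[L] N, g.toEmbedding = f := by
  refine ⟨⟨f, fun n φ x => ?_⟩, by ext; rfl⟩
  rw [← Formula.realize_relabel_sumInr φ (v := default),
    ← Formula.realize_relabel_sumInr φ (v := default)]
  exact IsRich.realize_iff hNT hMT hN hM _ (.of_embedding f x)

end Rich

/-! ### First-order axioms for richness -/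

section RichAxioms

variable {L : Language.{u, v}}

/-- `s` is a system of finite sets of atomic formulas, which suffice to determine the atomic types
of tuples in models of `T`. -/
structure DeterminesAtomic (T : L.Theory) (s : ∀ n, Finset (L.BoundedFormula Empty n)) : Prop where
  isAtomic : ∀ n, ∀ φ ∈ s n, φ.IsAtomic
  sameAtomic : ∀ M ∈ Theory.models.{u, v, w} T, ∀ N ∈ Theory.models.{u, v, w} T,
    ∀ (n : ℕ) (a : Fin n → M) (b : Fin n → N),
      (∀ φ ∈ s n, φ.Realize default a ↔ φ.Realize default b) → SameAtomic L a b

open Classical in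
/-- The conjunction of all formulas in `s` satisfied by `b` and of the negations of the others. -/
noncomputable def typeFormula {n : ℕ} (s : Finset (L.BoundedFormula Empty n)) {N : Type*}
    [L.Structure N] (b : Fin n → N) : L.BoundedFormula Empty n :=
  BoundedFormula.iInf fun φ : s => if φ.1.Realize default b then φ.1 else φ.1.not

theorem realize_typeFormula {n : ℕ} {s : Finset (L.BoundedFormula Empty n)} {M N : Type*}
    [L.Structure M] [L.Structure N] {a : Fin n → M} {b : Fin n → N} :
    (typeFormula s b).Realize default a ↔
      ∀ φ ∈ s, φ.Realize default a ↔ φ.Realize default b := by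
  rw [typeFormula, BoundedFormula.realize_iInf, Subtype.forall]
  refine forall₂_congr fun φ _ => ?_
  split_ifs with h <;> simp [h]

theorem DeterminesAtomic.realize_typeFormula_iff {T : L.Theory}
    {s : ∀ n, Finset (L.BoundedFormula Empty n)} (hs : DeterminesAtomic.{u, v, w} T s)
    {M N : CategoryTheory.Bundled.{w} L.Structure} (hM : M ∈ Theory.models T)
    (hN : N ∈ Theory.models T) {n : ℕ} {a : Fin n → M} {b : Fin n → N} :
    (typeFormula (s n) b).Realize default a ↔ SameAtomic L a b :=
  realize_typeFormula.trans
    ⟨hs.sameAtomic M hM N hN n a b, fun h φ hφ => h φ (hs.isAtomic n φ hφ)⟩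

/-- The axioms which say that a model of `T` is rich. -/
def richAxioms (T : L.Theory) (s : ∀ n, Finset (L.BoundedFormula Empty n)) : L.Theory :=
  {χ | ∃ N ∈ Theory.models.{u, v, w} T, ∃ (n : ℕ) (b : Fin n → N) (z : N),
    χ = ((typeFormula (s n) b).imp
      (typeFormula (s (n + 1)) (Fin.snoc b z : Fin (n + 1) → N)).ex).alls}

/-- A single formula captures each atomic type among models of `T`, so each instance of richness is
a single sentence. -/
theorem DeterminesAtomic.mem_models_iff {T : L.Theory}
    {s : ∀ n, Finset (L.BoundedFormula Empty n)} (hs : DeterminesAtomic.{u, v, w} T s)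
    {M : CategoryTheory.Bundled.{w} L.Structure} :
    M ∈ Theory.models (T ∪ richAxioms.{u, v, w} T s) ↔
      M ∈ Theory.models T ∧ IsRich.{u, v, w} T M := by
  have key : ∀ hM : M ∈ Theory.models T, ∀ N ∈ Theory.models.{u, v, w} T,
      ∀ (n : ℕ) (b : Fin n → N) (z : N),
      (M ⊨ ((typeFormula (s n) b).imp
        (typeFormula (s (n + 1)) (Fin.snoc b z : Fin (n + 1) → N)).ex).alls ↔
      ∀ a : Fin n → M, SameAtomic L a b →
        ∃ y : M, SameAtomic L (Fin.snoc a y : Fin (n + 1) → M)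
          (Fin.snoc b z : Fin (n + 1) → N)) := by
    intro hM N hN n b z
    rw [Sentence.Realize, BoundedFormula.realize_alls]
    simp only [BoundedFormula.realize_imp, BoundedFormula.realize_ex,
      hs.realize_typeFormula_iff hM hN]
  simp only [Theory.models, Set.mem_ofPred_eq, Theory.model_iff, Set.mem_union] at key ⊢
  refine ⟨fun h => ⟨fun φ hφ => h φ (.inl hφ), fun N hN n a b z hab => ?_⟩, ?_⟩
  · exact (key (fun φ hφ => h φ (.inl hφ)) N (Theory.model_iff _ |>.1 hN) n b z).1
      (h _ (.inr ⟨N, hN, n, b, z, rfl⟩)) a hab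
  · rintro ⟨hM, hR⟩ φ (hφ | ⟨N, hN, n, b, z, rfl⟩)
    · exact hM φ hφ
    · exact (key hM N (Theory.model_iff _ |>.1 hN) n b z).2 fun a => hR N hN n a b z

end RichAxioms

end FirstOrder.Language

namespace FirstOrder.Language

/-! ### Embeddings into ultraproducts -/

section UltraproductEmbedding

variable {L : Language.{u, v}} {α : Type*} (U : Ultrafilter α) {M : Type*} [L.Structure M]
  {N : α → Type*} [∀ i, L.Structure (N i)]

/-- The embedding into an ultraproduct induced by a family of embeddings. -/
def Ultraproduct.embeddingOfFamily (f : ∀ i, M ↪[L] N i) : M ↪[L] (U : Filter α).Product N where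
  toFun m := ((fun i => f i m : ∀ i, N i) : (U : Filter α).Product N)
  inj' x y h := by
    have h' : ∀ᶠ i in (U : Filter α), f i x = f i y := Quotient.exact h
    obtain ⟨i, hi⟩ := h'.exists
    exact (f i).injective hi
  map_fun' F x := by
    refine Eq.trans ?_ (Ultraproduct.funMap_cast F fun k i => f i (x k)).symm
    congr 1
    funext i
    exact (f i).map_fun F x
  map_rel' r x := by
    have h : Structure.RelMap r
        (fun k => ((fun i => f i (x k) : ∀ i, N i) : (U : Filter α).Product N)) ↔
        ∀ᶠ i in (U : Filter α), Structure.RelMap r fun k => f i (x k) := by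
      apply relMap_quotient_mk'
    refine h.trans ?_
    have h' : ∀ i, Structure.RelMap r (fun k => f i (x k)) ↔ Structure.RelMap r x :=
      fun i => (f i).map_rel r x
    simp only [h', Filter.eventually_const]

end UltraproductEmbedding

/-! ### Universal sentences in direct limits -/

section DirectLimit

variable {L : Language.{u, v}} {ι : Type*} [Preorder ι] [IsDirectedOrder ι] [Nonempty ι]
  {G : ι → Type w} [∀ i, L.Structure (G i)] {f : ∀ i j, i ≤ j → G i ↪[L] G j}
  [DirectedSystem G fun i j h => f i j h]

theorem DirectLimit.exists_of_comp_eq {α : Type*} [Finite α] (x : α → DirectLimit G f) :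
    ∃ (i : ι) (y : α → G i), DirectLimit.of L ι G f i ∘ y = x := by
  obtain ⟨i, y, rfl⟩ := DirectLimit.exists_quotient_mk'_sigma_mk'_eq G f x
  exact ⟨i, y, rfl⟩

/-- Quantifying over all lifts of `x` lets the induction pass a quantifier: a lift of `x` extended
by `z` restricts to a lift of `x` at the same stage. -/
theorem DirectLimit.realize_of_isUniversal {n : ℕ} {φ : L.BoundedFormula Empty n}
    (hφ : φ.IsUniversal) (x : Fin n → DirectLimit G f)
    (h : ∀ (i : ι) (y : Fin n → G i), DirectLimit.of L ι G f i ∘ y = x → φ.Realize default y) :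
    φ.Realize default x := by
  induction hφ with
  | of_isQF hQ =>
    obtain ⟨i, y, rfl⟩ := DirectLimit.exists_of_comp_eq x
    rw [← Subsingleton.elim (DirectLimit.of L ι G f i ∘ default) default,
      hQ.realize_embedding]
    exact h i y rfl
  | all _ ih =>
    intro z
    refine ih _ fun i y hy => ?_
    have := h i (Fin.init y) ?_ (y (Fin.last _))
    · rwa [Fin.snoc_init_self] at this
    · funext k
      have := congrFun hy k.castSucc
      rwa [Fin.snoc_castSucc] at this

theorem DirectLimit.models_of_isUniversal {T : L.Theory} [hT : T.IsUniversal]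
    (h : ∀ i, G i ⊨ T) : DirectLimit G f ⊨ T := by
  refine (Theory.model_iff _).2 fun φ hφ => ?_
  refine DirectLimit.realize_of_isUniversal (hT.isUniversal_of_mem hφ) _ fun i y _ => ?_
  have := (Theory.model_iff _).1 (h i) φ hφ
  rwa [Sentence.Realize, Formula.Realize, ← Subsingleton.elim y default] at this

end DirectLimit

/-! ### Rich extensions and the model completion criterion -/

section RichExtension

variable {L : Language.{u, v}}

theorem snoc_comp_eq {A B : Type*} {n : ℕ} (f : A → B) (a : Fin n → A) (y : A) :
    f ∘ (Fin.snoc a y : Fin (n + 1) → A) = Fin.snoc (f ∘ a) (f y) := by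
  funext k
  refine Fin.lastCases ?_ (fun k => ?_) k <;> simp

/-- Amalgamate `M` and `N` over the substructure generated by `b`, which also embeds in `M` through
`a`. This substructure may be empty when `n = 0`. -/
theorem exists_extension_of_sameAtomic {T : L.Theory} [T.IsUniversal]
    (hAP : Amalgamation (Theory.models.{u, v, w} T))
    {M N : CategoryTheory.Bundled.{w} L.Structure}
    (hM : M ∈ Theory.models T) (hN : N ∈ Theory.models T) {n : ℕ} {a : Fin n → M} {b : Fin n → N}
    (z : N) (h : SameAtomic L a b) :
    ∃ Q ∈ Theory.models.{u, v, w} T, ∃ (f : M ↪[L] Q) (y : Q),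
      SameAtomic L (Fin.snoc (f ∘ a) y : Fin (n + 1) → Q) (Fin.snoc b z : Fin (n + 1) → N) := by
  obtain ⟨e, he⟩ := h.exists_embedding
  let S := Substructure.closure L (Set.range b)
  have hN' : N ⊨ T := hN
  have hS : S ⊨ T := inferInstance
  obtain ⟨Q, i, j, hQ, hij⟩ := hAP ⟨S, inferInstance⟩ M N e S.subtype hS hM hN
  refine ⟨Q, hQ, i, j z, ?_⟩
  have : i ∘ a = j ∘ b := by
    funext k
    have hk : b k ∈ S := Substructure.subset_closure ⟨k, rfl⟩
    have := DFunLike.congr_fun hij ⟨b k, hk⟩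
    simpa [he k hk] using this
  rw [this, ← snoc_comp_eq]
  exact .of_embedding j _

theorem SameAtomic.snoc_embedding {M N P : Type*} [L.Structure M] [L.Structure N] [L.Structure P]
    {n : ℕ} {a : Fin n → M} {y : M} {b : Fin (n + 1) → N} (f : M ↪[L] P)
    (h : SameAtomic L (Fin.snoc a y : Fin (n + 1) → M) b) :
    SameAtomic L (Fin.snoc (f ∘ a) (f y) : Fin (n + 1) → P) b := by
  rw [← snoc_comp_eq]
  exact (SameAtomic.of_embedding f _).trans h

/-- Every one-point extension of atomic types over `M` can be realized in a single extension
of `M`. -/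
theorem exists_extension_realizing {T : L.Theory} [T.IsUniversal]
    {s : ∀ n, Finset (L.BoundedFormula Empty n)}
    (hs : DeterminesAtomic.{u, v, max u v w} T s)
    (hAP : Amalgamation (Theory.models.{u, v, max u v w} T))
    (M : CategoryTheory.Bundled.{max u v w} L.Structure) (hM : M ∈ Theory.models T) :
    ∃ Q ∈ Theory.models.{u, v, max u v w} T, ∃ f : M ↪[L] Q,
      ∀ N ∈ Theory.models.{u, v, max u v w} T, ∀ (n : ℕ) (a : Fin n → M) (b : Fin n → N) (z : N),
        SameAtomic L a b → ∃ y : Q, SameAtomic L (Fin.snoc (f ∘ a) y : Fin (n + 1) → Q)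
          (Fin.snoc b z : Fin (n + 1) → N) := by
  classical
  -- Requests record a formula instead of the model `N`, so that they form a type in the universe of
  -- the models.
  let Req : Type (max u v w) := {r : Σ n, (Fin n → M) × L.BoundedFormula Empty (n + 1) //
    ∃ N ∈ Theory.models.{u, v, max u v w} T, ∃ (b : Fin r.1 → N) (z : N),
      SameAtomic L r.2.1 b ∧
        r.2.2 = typeFormula (s (r.1 + 1)) (Fin.snoc b z : Fin (r.1 + 1) → N)}
  choose N hN b z hab hψ using fun r : Req => r.2
  rcases isEmpty_or_nonempty Req with hReq | ⟨⟨r₀⟩⟩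
  · exact ⟨M, hM, Embedding.refl L M, fun N hN n a b z hab =>
      (hReq.false ⟨⟨n, a, typeFormula (s (n + 1)) (Fin.snoc b z : Fin (n + 1) → N)⟩,
        N, hN, b, z, hab, rfl⟩).elim⟩
  have hfin : ∀ S : Finset Req, ∃ Q ∈ Theory.models.{u, v, max u v w} T, ∃ f : M ↪[L] Q,
      ∀ r ∈ S, ∃ y : Q, SameAtomic L (Fin.snoc (f ∘ r.1.2.1) y : Fin (r.1.1 + 1) → Q)
        (Fin.snoc (b r) (z r) : Fin (r.1.1 + 1) → N r) := by
    intro S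
    induction S using Finset.induction_on with
    | empty => exact ⟨M, hM, Embedding.refl L M, by simp⟩
    | insert r S _ ih =>
      obtain ⟨Q, hQ, f, hf⟩ := ih
      obtain ⟨Q', hQ', f', y, hy⟩ := exists_extension_of_sameAtomic hAP hQ (hN r) (z r)
        ((SameAtomic.of_embedding f _).trans (hab r))
      refine ⟨Q', hQ', f'.comp f, fun r' hr' => ?_⟩
      rcases Finset.mem_insert.1 hr' with rfl | hr'
      · exact ⟨y, hy⟩
      · obtain ⟨y', hy'⟩ := hf r' hr'
        exact ⟨f' y', hy'.snoc_embedding f'⟩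
  -- Always including `r₀` makes every `Q S` nonempty, as Łoś's theorem requires.
  choose Q hQ f hf using fun S : Finset Req => hfin (insert r₀ S)
  have hne : ∀ S, Nonempty (Q S) := fun S => (hf S r₀ (Finset.mem_insert_self _ _)).nonempty
  let U : Ultrafilter (Finset Req) := Ultrafilter.of Filter.atTop
  have hU : (U : Filter (Finset Req)) ≤ Filter.atTop := Ultrafilter.of_le _
  let P : CategoryTheory.Bundled.{max u v w} L.Structure :=
    ⟨(U : Filter (Finset Req)).Product fun S => Q S, inferInstance⟩
  have hP : P ∈ Theory.models T := by
    refine (Theory.model_iff _).2 fun φ hφ => ?_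
    refine (Ultraproduct.sentence_realize φ).2 (Filter.Eventually.of_forall fun S => ?_)
    exact (Theory.model_iff _).1 (hQ S) φ hφ
  let F : M ↪[L] P := Ultraproduct.embeddingOfFamily U f
  refine ⟨P, hP, F, fun N' hN' n a b' z' hab' => ?_⟩
  let r : Req := ⟨⟨n, a, typeFormula (s (n + 1)) (Fin.snoc b' z' : Fin (n + 1) → N')⟩,
    N', hN', b', z', hab', rfl⟩
  have hr : ∀ᶠ S in (U : Filter (Finset Req)), (typeFormula (s (n + 1))
      (Fin.snoc b' z' : Fin (n + 1) → N')).ex.Realize default (f S ∘ a) := by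
    refine hU ((Filter.eventually_ge_atTop {r}).mono fun S hS => ?_)
    obtain ⟨y, hy⟩ := hf S r (Finset.mem_insert_of_mem (hS (Finset.mem_singleton_self r)))
    refine BoundedFormula.realize_ex.2 ⟨y, ?_⟩
    -- The witnesses chosen for `r` may differ from `N'`, `b'`, `z'`, but they define the same
    -- formula.
    have := (hs.realize_typeFormula_iff (hQ S) (hN r)).2 hy
    rwa [← hψ r] at this
  have hr' : (typeFormula (s (n + 1))
      (Fin.snoc b' z' : Fin (n + 1) → N')).ex.Realize default (F ∘ a) := by
    have := (Ultraproduct.boundedFormula_realize_cast (M := fun S => Q S) (u := U)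
      (typeFormula (s (n + 1)) (Fin.snoc b' z' : Fin (n + 1) → N')).ex
      (fun e : Empty => e.elim) (fun k S => f S (a k))).2
        (hr.mono fun S hS => by convert! hS)
    rw [← Subsingleton.elim (fun i : Empty => _) default]
    exact this
  obtain ⟨y, hy⟩ := BoundedFormula.realize_ex.1 hr'
  exact ⟨y, (hs.realize_typeFormula_iff hP hN').1 hy⟩

/-- Iterate the previous extension along a countable chain: a finite tuple of the limit lives at
some stage, and its extensions are realized at the next one. -/
theorem exists_rich_extension {T : L.Theory} [T.IsUniversal]
    {s : ∀ n, Finset (L.BoundedFormula Empty n)}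
    (hs : DeterminesAtomic.{u, v, max u v w} T s)
    (hAP : Amalgamation (Theory.models.{u, v, max u v w} T))
    (M : CategoryTheory.Bundled.{max u v w} L.Structure) (hM : M ∈ Theory.models T) :
    ∃ Q ∈ Theory.models.{u, v, max u v w} T, IsRich.{u, v, max u v w} T Q ∧
      Nonempty (M ↪[L] Q) := by
  choose E hE e he using exists_extension_realizing.{u, v, w} hs hAP
  let G : ℕ → {M : CategoryTheory.Bundled.{max u v w} L.Structure // M ∈ Theory.models T} :=
    Nat.rec ⟨M, hM⟩ fun _ K => ⟨E K.1 K.2, hE K.1 K.2⟩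
  let G' : ℕ → Type (max u v w) := fun n => (G n).1
  let g : ∀ n, G' n ↪[L] G' (n + 1) := fun n => e (G n).1 (G n).2
  let ι : ∀ n, G' n ↪[L] DirectLimit G' (DirectedSystem.natLERec g) :=
    DirectLimit.of L ℕ G' (DirectedSystem.natLERec g)
  have hι : ∀ n x, ι (n + 1) (g n x) = ι n x := by
    intro n x
    have h : DirectedSystem.natLERec g n (n + 1) n.le_succ x = g n x := by
      rw [DirectedSystem.coe_natLERec]
      exact Nat.leRecOn_succ' (C := G') x
    rw [← h]
    exact DirectLimit.of_f
  refine ⟨⟨DirectLimit G' (DirectedSystem.natLERec g), inferInstance⟩,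
    DirectLimit.models_of_isUniversal fun n => (G n).2, ?_, ⟨ι 0⟩⟩
  intro N hN n a b z hab
  obtain ⟨i, a', rfl⟩ := DirectLimit.exists_of_comp_eq a
  obtain ⟨y, hy⟩ := he (G i).1 (G i).2 N hN n a' b z ((SameAtomic.of_embedding _ a').symm.trans hab)
  refine ⟨ι (i + 1) y, ?_⟩
  have : DirectLimit.of L ℕ G' (DirectedSystem.natLERec g) i ∘ a' = ι (i + 1) ∘ (g i ∘ a') :=
    funext fun k => (hι i (a' k)).symm
  rw [this]
  exact SameAtomic.snoc_embedding (ι (i + 1)) hy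

/-- A universal theory with the amalgamation property, which has only finitely many atomic types
in each finite number of variables in a uniform way, has a model completion. -/
theorem Theory.isModelCompletion_richAxioms {T : L.Theory} [T.IsUniversal]
    {s : ∀ n, Finset (L.BoundedFormula Empty n)}
    (hs : DeterminesAtomic.{u, v, max u v w} T s)
    (hAP : Amalgamation (Theory.models.{u, v, max u v w} T)) :
    Theory.IsModelCompletion.{u, v, max u v w} T (T ∪ richAxioms.{u, v, max u v w} T s) := by
  refine ⟨⟨fun M hM N hN f => ?_, fun φ hφ => ⟨fun h M hM => ?_, fun h M hM => ?_⟩⟩, hAP⟩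
  · rw [hs.mem_models_iff] at hM hN
    exact IsRich.exists_elementaryEmbedding hM.1 hN.1 hM.2 hN.2 f
  · exact h M (hs.mem_models_iff.1 hM).1
  · obtain ⟨Q, hQ, hR, ⟨f⟩⟩ := exists_rich_extension.{u, v, w} hs hAP M hM
    have := h Q (hs.mem_models_iff.2 ⟨hQ, hR⟩)
    refine hφ.realize_embedding f ?_
    rwa [Subsingleton.elim (f ∘ default) default, Subsingleton.elim (f ∘ default) default]

end RichExtension

end FirstOrder.Language

namespace FirstOrder.Language

/-! ### Models of the expanded theory -/

section Expansion

variable {L : Language.{u, v}} {k : ℕ}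

/-- The interpretation of `Kᵢ`. -/
def opFun (L : Language.{u, v}) {M : Type*} [(L.addOps k).Structure M] (i : Fin k) (x : M) : M :=
  Structure.funMap (opSymbol L i) ![x]

theorem realize_opTerm {M : Type*} [(L.addOps k).Structure M] (i : Fin k) {n : ℕ}
    (t : (L.addOps k).Term (Empty ⊕ Fin n)) (a : Empty ⊕ Fin n → M) :
    (opTerm i t).realize a = opFun L i (t.realize a) :=
  Term.realize_functions_apply₁

theorem Embedding.map_opFun {M N : Type*} [(L.addOps k).Structure M] [(L.addOps k).Structure N]
    (f : M ↪[L.addOps k] N) (i : Fin k) (x : M) : f (opFun L i x) = opFun L i (f x) :=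
  (f.map_fun _ _).trans (congrArg _ (funext fun m => by rw [Subsingleton.elim m 0]; rfl))

/-- The property of a unary operation `K` expressed by the axioms for a requirement. -/
def OpKind.Holds {M : Type*} (r : M → M → Prop) (K : M → M) : OpKind → Prop
  | idempotent => ∀ x, K (K x) = K x
  | idempotentIsotone => (∀ x, K (K x) = K x) ∧ ∀ x y, r x y → r (K x) (K y)
  | idempotentExtensive => (∀ x, K (K x) = K x) ∧ ∀ x, r x (K x)
  | closure => (∀ x, K (K x) = K x) ∧ (∀ x y, r x y → r (K x) (K y)) ∧ ∀ x, r x (K x)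

theorem OpKind.Holds.idem {M : Type*} {r : M → M → Prop} {K : M → M} {κ : OpKind}
    (h : κ.Holds r K) (x : M) : K (K x) = K x := by
  cases κ
  exacts [h x, h.1 x, h.1 x, h.1 x]

section Axioms

variable {M : Type*} [(L.addOps k).Structure M]

theorem realize_idempotentAxiom (i : Fin k) :
    M ⊨ idempotentAxiom L i ↔ ∀ x : M, opFun L i (opFun L i x) = opFun L i x := by
  simp only [Sentence.Realize, Formula.Realize, idempotentAxiom, BoundedFormula.realize_all,
    BoundedFormula.realize_bdEqual, realize_opTerm]
  rfl

theorem realize_commuteAxiom (i j : Fin k) :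
    M ⊨ commuteAxiom L i j ↔ ∀ x : M, opFun L i (opFun L j x) = opFun L j (opFun L i x) := by
  simp only [Sentence.Realize, Formula.Realize, commuteAxiom, BoundedFormula.realize_all,
    BoundedFormula.realize_bdEqual, realize_opTerm]
  rfl

theorem realize_extensiveAxiom (R : L.Relations 2) (i : Fin k) :
    M ⊨ extensiveAxiom R i ↔ ∀ x : M, Structure.RelMap (liftRel k R) ![x, opFun L i x] := by
  simp only [Sentence.Realize, Formula.Realize, extensiveAxiom, BoundedFormula.realize_all,
    BoundedFormula.realize_rel₂, realize_opTerm]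
  rfl

theorem realize_isotoneAxiom (R : L.Relations 2) (i : Fin k) :
    M ⊨ isotoneAxiom R i ↔ ∀ x y : M, Structure.RelMap (liftRel k R) ![x, y] →
      Structure.RelMap (liftRel k R) ![opFun L i x, opFun L i y] := by
  simp only [Sentence.Realize, Formula.Realize, isotoneAxiom, BoundedFormula.realize_all,
    BoundedFormula.realize_imp, BoundedFormula.realize_rel₂, realize_opTerm]
  rfl

theorem OpKind.model_axioms_iff (R : L.Relations 2) (i : Fin k) (κ : OpKind) :
    M ⊨ κ.axioms R i ↔
      κ.Holds (fun x y : M => Structure.RelMap (liftRel k R) ![x, y]) (opFun L i) := by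
  cases κ <;>
  simp [OpKind.axioms, OpKind.Holds, Theory.model_iff, realize_idempotentAxiom,
    realize_extensiveAxiom, realize_isotoneAxiom]

end Axioms

/-- The `L`-reduct of a structure. -/
@[reducible]
def reductBundled (M : CategoryTheory.Bundled.{w} (L.addOps k).Structure) :
    CategoryTheory.Bundled.{w} L.Structure :=
  ⟨M, (LHom.sumInl : L →ᴸ L.addOps k).reduct M⟩

/-- An embedding, as an embedding between reducts. -/
def reductEmbedding {M N : CategoryTheory.Bundled.{w} (L.addOps k).Structure}
    (f : M ↪[L.addOps k] N) : reductBundled M ↪[L] reductBundled N where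
  toFun := f
  inj' := f.injective
  map_fun' F x := f.map_fun (Sum.inl F) x
  map_rel' r x := f.map_rel (Sum.inl r) x

theorem Theory.mem_models_expand_iff {T : L.Theory} {R : L.Relations 2} {kind : Fin k → OpKind}
    {M : CategoryTheory.Bundled.{w} (L.addOps k).Structure} :
    M ∈ Theory.models (T.expand R kind) ↔ reductBundled M ∈ Theory.models T ∧
      (∀ i, (kind i).Holds (fun x y : M => Structure.RelMap (liftRel k R) ![x, y]) (opFun L i)) ∧
      ∀ (i j : Fin k) (x : M), opFun L i (opFun L j x) = opFun L j (opFun L i x) := by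
  let := (LHom.sumInl : L →ᴸ L.addOps k).reduct M
  have hT : M ⊨ (LHom.sumInl : L →ᴸ L.addOps k).onTheory T ↔ M ⊨ T := by
    have := (LHom.sumInl : L →ᴸ L.addOps k).isExpansionOn_reduct M
    exact LHom.onTheory_model _ _
  have h : M ⊨ T.expand R kind ↔ M ⊨ (LHom.sumInl : L →ᴸ L.addOps k).onTheory T ∧
      (∀ i, M ⊨ (kind i).axioms R i) ∧ ∀ i j : Fin k, M ⊨ commuteAxiom L i j := by
    simp only [Theory.expand, Theory.model_iff, Set.mem_union, Set.mem_iUnion]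
    constructor
    · exact fun h => ⟨fun φ hφ => h φ (.inl (.inl hφ)), fun i φ hφ => h φ (.inl (.inr ⟨i, hφ⟩)),
        fun i j => h _ (.inr ⟨i, j, rfl⟩)⟩
    · rintro ⟨h₁, h₂, h₃⟩ φ ((hφ | ⟨i, hφ⟩) | ⟨i, j, rfl⟩)
      exacts [h₁ φ hφ, h₂ i φ hφ, h₃ i j]
  simp only [OpKind.model_axioms_iff, realize_commuteAxiom, hT] at h
  exact h

theorem LHom.isQF_onBoundedFormula {L' : Language} (Φ : L →ᴸ L') {α : Type*} {n : ℕ}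
    {φ : L.BoundedFormula α n} (h : φ.IsQF) : (Φ.onBoundedFormula φ).IsQF := by
  induction h with
  | falsum => exact .falsum
  | of_isAtomic h =>
    cases h with
    | equal t s => exact (BoundedFormula.IsAtomic.equal _ _).isQF
    | rel r t => exact (BoundedFormula.IsAtomic.rel _ _).isQF
  | imp _ _ ih₁ ih₂ => exact ih₁.imp ih₂

theorem LHom.isUniversal_onBoundedFormula {L' : Language} (Φ : L →ᴸ L') {α : Type*} {n : ℕ}
    {φ : L.BoundedFormula α n} (h : φ.IsUniversal) : (Φ.onBoundedFormula φ).IsUniversal := by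
  induction h with
  | of_isQF h => exact (LHom.isQF_onBoundedFormula Φ h).isUniversal
  | all _ ih => exact ih.all

theorem OpKind.isUniversal_of_mem_axioms (R : L.Relations 2) (i : Fin k) (κ : OpKind)
    {φ : (L.addOps k).Sentence} (hφ : φ ∈ κ.axioms R i) : φ.IsUniversal := by
  have h₁ : (idempotentAxiom L i).IsUniversal := (BoundedFormula.IsAtomic.equal _ _).isUniversal.all
  have h₂ : (isotoneAxiom R i).IsUniversal :=
    ((Relations.isQF _ _).imp (Relations.isQF _ _)).isUniversal.all.all
  have h₃ : (extensiveAxiom R i).IsUniversal := (Relations.isQF _ _).isUniversal.all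
  cases κ <;> simp only [OpKind.axioms, Set.mem_insert_iff, Set.mem_singleton_iff] at hφ <;>
    rcases hφ with rfl | rfl | rfl <;> assumption

instance Theory.isUniversal_expand (T : L.Theory) [hT : T.IsUniversal] (R : L.Relations 2)
    (kind : Fin k → OpKind) : (T.expand R kind).IsUniversal where
  isUniversal_of_mem φ := by
    rintro ((⟨ψ, hψ, rfl⟩ | hφ) | ⟨i, j, rfl⟩)
    · exact LHom.isUniversal_onBoundedFormula _ (hT.isUniversal_of_mem hψ)
    · obtain ⟨i, hi⟩ := Set.mem_iUnion.1 hφ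
      exact OpKind.isUniversal_of_mem_axioms R i _ hi
    · exact (BoundedFormula.IsAtomic.equal _ _).isUniversal.all

/-! ### Finiteness of atomic types with operations -/

section FinitelyManyTypes

/-- The term obtained by applying the operations in a list to a variable. -/
def opsTerm (L : Language.{u, v}) {n : ℕ} (q : {l : List (Fin k) // l.Nodup} × Fin n) :
    (L.addOps k).Term (Empty ⊕ Fin n) :=
  q.1.1.foldr (fun i t => opTerm i t) (&q.2)

/-- The operation commutes inwards to its own occurrence in `l` and is absorbed by idempotence. -/
theorem opFun_realize_foldr_of_mem {M : Type*} [(L.addOps k).Structure M]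
    (hidem : ∀ (i : Fin k) (x : M), opFun L i (opFun L i x) = opFun L i x)
    (hcomm : ∀ (i j : Fin k) (x : M), opFun L i (opFun L j x) = opFun L j (opFun L i x))
    {n : ℕ} (t : (L.addOps k).Term (Empty ⊕ Fin n)) (a : Empty ⊕ Fin n → M) {i : Fin k}
    {l : List (Fin k)} (hi : i ∈ l) :
    opFun L i ((l.foldr (fun i t => opTerm i t) t).realize a) =
      (l.foldr (fun i t => opTerm i t) t).realize a := by
  induction l with
  | nil => simp at hi
  | cons j l ih =>
    rw [List.foldr_cons, realize_opTerm]
    rcases List.mem_cons.1 hi with rfl | hi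
    · exact hidem _ _
    · rw [hcomm, ih hi]

/-- Each term is equivalent to one which applies distinct operations to a variable. -/
theorem exists_opsTerm [L.IsRelational] {n : ℕ} (t : (L.addOps k).Term (Empty ⊕ Fin n)) :
    ∃ q : {l : List (Fin k) // l.Nodup} × Fin n,
      ∀ (M : Type w) [(L.addOps k).Structure M],
        (∀ (i : Fin k) (x : M), opFun L i (opFun L i x) = opFun L i x) →
        (∀ (i j : Fin k) (x : M), opFun L i (opFun L j x) = opFun L j (opFun L i x)) →
        ∀ a : Empty ⊕ Fin n → M, t.realize a = (opsTerm L q).realize a := by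
  induction t with
  | var x =>
    rcases x with x | j
    · exact x.elim
    · exact ⟨⟨⟨[], List.nodup_nil⟩, j⟩, fun M _ _ _ a => rfl⟩
  | func F ts ih =>
    rcases F with F | F
    · exact isEmptyElim F
    · change OpFunctions k _ at F
      cases F with | op i =>
      obtain ⟨⟨⟨l, hl⟩, j⟩, hq⟩ := ih 0
      have key : ∀ (M : Type w) [(L.addOps k).Structure M] (a : Empty ⊕ Fin n → M),
          (Term.func (Sum.inr (OpFunctions.op i)) ts : (L.addOps k).Term (Empty ⊕ Fin n)).realize a
            = opFun L i ((ts 0).realize a) := by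
        intro M _ a
        refine congrArg (Structure.funMap (opSymbol L i)) (funext fun m => ?_)
        rw [Subsingleton.elim m 0]
        rfl
      by_cases hi : i ∈ l
      · refine ⟨⟨⟨l, hl⟩, j⟩, fun M _ hidem hcomm a => ?_⟩
        rw [key, hq M hidem hcomm]
        exact opFun_realize_foldr_of_mem hidem hcomm _ a hi
      · refine ⟨⟨⟨i :: l, List.nodup_cons.2 ⟨hi, hl⟩⟩, j⟩, fun M _ hidem hcomm a => ?_⟩
        rw [key, hq M hidem hcomm]
        exact (realize_opTerm i _ a).symm

/-- The atomic formulas in the terms `opsTerm`. -/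
def opsAtomic (L : Language.{u, v}) (k n : ℕ) : Set ((L.addOps k).BoundedFormula Empty n) :=
  Set.range (fun q : ({l : List (Fin k) // l.Nodup} × Fin n) ×
      ({l : List (Fin k) // l.Nodup} × Fin n) => (opsTerm L q.1).bdEqual (opsTerm L q.2)) ∪
    Set.range (fun q : Σ r : Σ m, L.Relations m, Fin r.1 → {l : List (Fin k) // l.Nodup} × Fin n =>
      Relations.boundedFormula (L := L.addOps k) (Sum.inl q.1.2) fun i => opsTerm L (q.2 i))

theorem finite_opsAtomic [Finite L.Symbols] (k n : ℕ) : (opsAtomic L k n).Finite := by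
  have : Finite (Σ m, L.Relations m) :=
    Finite.of_injective (Sum.inr : _ → L.Symbols) Sum.inr_injective
  exact (Set.finite_range _).union (Set.finite_range _)

theorem determinesAtomic_expand [L.IsRelational] [Finite L.Symbols] (T : L.Theory)
    (R : L.Relations 2) (kind : Fin k → OpKind) :
    DeterminesAtomic.{u, v, w} (T.expand R kind) fun n => (finite_opsAtomic (L := L) k n).toFinset where
  isAtomic n φ hφ := by
    rcases (Set.Finite.mem_toFinset _).1 hφ with ⟨q, rfl⟩ | ⟨q, rfl⟩
    exacts [.equal _ _, .rel _ _]
  sameAtomic M hM N hN n a b h := by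
    simp only [Set.Finite.mem_toFinset] at h
    obtain ⟨-, hM₁, hM₂⟩ := Theory.mem_models_expand_iff.1 hM
    obtain ⟨-, hN₁, hN₂⟩ := Theory.mem_models_expand_iff.1 hN
    -- The normal form depends on the term alone, so the same one serves in both `M` and `N`.
    choose q hq using fun t : (L.addOps k).Term (Empty ⊕ Fin n) => exists_opsTerm.{u, v, w} t
    have hqM := fun t => hq t M (fun i => (hM₁ i).idem) hM₂
    have hqN := fun t => hq t N (fun i => (hN₁ i).idem) hN₂
    rintro φ (⟨t, s⟩ | ⟨r, t⟩)
    · have := h _ (.inl ⟨(q t, q s), rfl⟩)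
      simpa only [BoundedFormula.realize_bdEqual, ← hqM, ← hqN] using this
    · rcases r with r | r
      · have := h _ (.inr ⟨⟨⟨_, r⟩, fun i => q (t i)⟩, rfl⟩)
        change Structure.RelMap (L := L.addOps k) (Sum.inl r) (fun i => (t i).realize _) ↔
          Structure.RelMap (L := L.addOps k) (Sum.inl r) (fun i => (t i).realize _)
        rw [funext fun i => hqM (t i) _, funext fun i => hqN (t i) _]
        exact this
      · exact r.elim

end FinitelyManyTypes

/-! ### Amalgamating structures with operations -/

section AmalgamationOfExpansions

/-- The `L ∪ {K₀, …, Kₖ₋₁}`-structure given by an `L`-structure and `k` operations. -/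
@[reducible]
def expandStructure {D : Type*} (S : L.Structure D) (K : Fin k → D → D) :
    (L.addOps k).Structure D where
  funMap {_} F := match F with
    | .inl F => fun x => S.funMap F x
    | .inr (.op i) => fun x => K i (x 0)
  RelMap {_} r := match r with
    | .inl r => fun x => S.RelMap r x
    | .inr r => r.elim

/-- An embedding of reducts which commutes with the operations. -/
def embeddingExpand {M : CategoryTheory.Bundled.{w} (L.addOps k).Structure}
    {D : CategoryTheory.Bundled.{w} L.Structure} (K : Fin k → D → D)
    (f : reductBundled M ↪[L] D) (hf : ∀ i (x : M), f (opFun L i x) = K i (f x)) :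
    letI := expandStructure D.str K
    M ↪[L.addOps k] D :=
  letI := expandStructure D.str K
  { toFun := f
    inj' := f.injective
    map_fun' := fun {n} F x => by
      rcases F with F | F
      · exact f.map_fun F x
      · change OpFunctions k _ at F
        cases F with | op i =>
        refine Eq.trans (congrArg f (congrArg _ ?_)) (hf i (x 0))
        funext m
        rw [Subsingleton.elim m 0]
        rfl
    map_rel' := fun {n} r x => by
      rcases r with r | r
      · exact f.map_rel r x
      · exact r.elim }

/-- The superamalgam can be chosen as a union. -/
theorem Superamalgamation.exists_union [L.IsRelational] {T : L.Theory} [T.IsUniversal]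
    {R : L.Relations 2} (hT : Superamalgamation (Theory.models.{u, v, w} T) R)
    {A B C : CategoryTheory.Bundled.{w} L.Structure} (f : C ↪[L] A) (g : C ↪[L] B)
    (hA : A ∈ Theory.models T) (hB : B ∈ Theory.models T) (hC : C ∈ Theory.models T) :
    ∃ (D : CategoryTheory.Bundled.{w} L.Structure) (i : A ↪[L] D) (j : B ↪[L] D),
      D ∈ Theory.models T ∧ (∀ d : D, (∃ a, i a = d) ∨ ∃ b, j b = d) ∧
      (∀ c : C, i (f c) = j (g c)) ∧
      (∀ (a : A) (b : B), i a = j b → ∃ c : C, f c = a ∧ g c = b) ∧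
      ∀ (a : A) (b : B), a ∉ Set.range f → b ∉ Set.range g →
        (Structure.RelMap R ![i a, j b] →
          ∃ c : C, Structure.RelMap R ![a, f c] ∧ Structure.RelMap R ![g c, b]) ∧
        (Structure.RelMap R ![j b, i a] →
          ∃ c : C, Structure.RelMap R ![b, g c] ∧ Structure.RelMap R ![f c, a]) := by
  obtain ⟨D, i, j, hD, hij, hint, hsuper⟩ := hT A B C f g hA hB hC
  -- Without function symbols every subset is a substructure, and universality of `T` passes to it.
  let S : L.Substructure D := ⟨Set.range i ∪ Set.range j, fun F => isEmptyElim F⟩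
  have hD' : D ⊨ T := hD
  have hS : S ⊨ T := inferInstance
  have hpair : ∀ x y : S, Structure.RelMap R ![x, y] → Structure.RelMap R ![(x : D), (y : D)] := by
    intro x y h
    have h' := (S.subtype.map_rel R ![x, y]).2 h
    rwa [show S.subtype ∘ ![x, y] = ![(x : D), (y : D)] by
      funext m; refine Fin.cases rfl (fun m => ?_) m; rw [Subsingleton.elim m 0]; rfl] at h'
  refine ⟨⟨S, inferInstance⟩, i.codRestrict S fun a => .inl ⟨a, rfl⟩,
    j.codRestrict S fun b => .inr ⟨b, rfl⟩, hS, ?_, fun c => Subtype.ext (hij c),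
    fun a b h => hint a b (congrArg Subtype.val h),
    fun a b ha hb => ⟨fun h => (hsuper a b ha hb).1 (hpair _ _ h),
      fun h => (hsuper a b ha hb).2 (hpair _ _ h)⟩⟩
  rintro ⟨d, ⟨a, rfl⟩ | ⟨b, rfl⟩⟩
  exacts [.inl ⟨a, rfl⟩, .inr ⟨b, rfl⟩]

/-- Unary operations on `A` and `B` which agree on `C` extend to `A ∪ B`. -/
theorem exists_op_union {A B C D : Type*} {i : A → D} {j : B → D} {f : C → A} {g : C → B}
    (hi : Function.Injective i) (hj : Function.Injective j)
    (hD : ∀ d : D, (∃ a, i a = d) ∨ ∃ b, j b = d) (hij : ∀ c, i (f c) = j (g c))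
    (hint : ∀ a b, i a = j b → ∃ c, f c = a ∧ g c = b) (KA : A → A) (KB : B → B) (KC : C → C)
    (hf : ∀ c, f (KC c) = KA (f c)) (hg : ∀ c, g (KC c) = KB (g c)) :
    ∃ K : D → D, (∀ a, i (KA a) = K (i a)) ∧ ∀ b, j (KB b) = K (j b) := by
  have hAB : ∀ a b, i a = j b → i (KA a) = j (KB b) := by
    intro a b h
    obtain ⟨c, rfl, rfl⟩ := hint a b h
    rw [← hf, ← hg, hij]
  -- The value is required to suit every representation of `d`, so the chosen `K` extends both
  -- operations.
  have key : ∀ d, ∃ e, (∀ a, i a = d → i (KA a) = e) ∧ ∀ b, j b = d → j (KB b) = e := by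
    intro d
    rcases hD d with ⟨a, rfl⟩ | ⟨b, rfl⟩
    · exact ⟨i (KA a), fun a' h => by rw [hi h], fun b h => (hAB a b h.symm).symm⟩
    · exact ⟨j (KB b), fun a h => hAB a b h, fun b' h => by rw [hj h]⟩
  choose K hK₁ hK₂ using key
  exact ⟨K, fun a => hK₁ _ a rfl, fun b => hK₂ _ b rfl⟩

/-- A requirement on an operation is inherited by a union. -/
theorem OpKind.Holds.union {A B D : Type*} {rA : A → A → Prop} {rB : B → B → Prop}
    {rD : D → D → Prop} {i : A → D} {j : B → D} {KA : A → A} {KB : B → B} {K : D → D}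
    (hi : ∀ a a', rD (i a) (i a') ↔ rA a a') (hj : ∀ b b', rD (j b) (j b') ↔ rB b b')
    (hD : ∀ d : D, (∃ a, i a = d) ∨ ∃ b, j b = d)
    (hKi : ∀ a, i (KA a) = K (i a)) (hKj : ∀ b, j (KB b) = K (j b))
    (hmono : (∀ x y, rA x y → rA (KA x) (KA y)) → (∀ x y, rB x y → rB (KB x) (KB y)) →
      ∀ a b, (rD (i a) (j b) → rD (i (KA a)) (j (KB b))) ∧
        (rD (j b) (i a) → rD (j (KB b)) (i (KA a))))
    {κ : OpKind} (hA : κ.Holds rA KA) (hB : κ.Holds rB KB) : κ.Holds rD K := by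
  have hidem : ∀ d, K (K d) = K d := by
    intro d
    rcases hD d with ⟨a, rfl⟩ | ⟨b, rfl⟩
    · rw [← hKi, ← hKi, hA.idem]
    · rw [← hKj, ← hKj, hB.idem]
  have hext (hA : ∀ x, rA x (KA x)) (hB : ∀ x, rB x (KB x)) : ∀ d, rD d (K d) := by
    intro d
    rcases hD d with ⟨a, rfl⟩ | ⟨b, rfl⟩
    · rw [← hKi, hi]; exact hA a
    · rw [← hKj, hj]; exact hB b
  have hiso (hA : ∀ x y, rA x y → rA (KA x) (KA y)) (hB : ∀ x y, rB x y → rB (KB x) (KB y)) :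
      ∀ x y, rD x y → rD (K x) (K y) := by
    intro x y
    rcases hD x with ⟨a, rfl⟩ | ⟨b, rfl⟩ <;> rcases hD y with ⟨a', rfl⟩ | ⟨b', rfl⟩ <;>
      simp only [← hKi, ← hKj]
    · rw [hi, hi]; exact hA a a'
    · exact (hmono hA hB a b').1
    · exact (hmono hA hB a' b).2
    · rw [hj, hj]; exact hB b b'
  cases κ
  · exact hidem
  · exact ⟨hidem, hiso hA.2 hB.2⟩
  · exact ⟨hidem, hext hA.2 hB.2⟩
  · exact ⟨hidem, hiso hA.2.1 hB.2.1, hext hA.2.2 hB.2.2⟩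

theorem Embedding.relMap_pair {M N : Type*} [L.Structure M] [L.Structure N] (f : M ↪[L] N)
    (R : L.Relations 2) (x y : M) :
    Structure.RelMap R ![f x, f y] ↔ Structure.RelMap R ![x, y] := by
  refine Iff.trans (iff_of_eq (congrArg _ ?_)) (f.map_rel R ![x, y])
  funext m
  refine Fin.cases rfl (fun m => ?_) m
  rw [Subsingleton.elim m 0]
  rfl

/-- Superamalgamation and transitivity serve only isotonicity across the two sides; the other
requirements are checked elementwise. -/
theorem amalgamation_expand [L.IsRelational] {T : L.Theory} [T.IsUniversal] {R : L.Relations 2}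
    (hR : Theory.Entails.{u, v, w} T R.transitive)
    (hT : Superamalgamation (Theory.models.{u, v, w} T) R) (kind : Fin k → OpKind) :
    Amalgamation (Theory.models.{u, v, w} (T.expand R kind)) := by
  intro C A B f g hC hA hB
  rw [Theory.mem_models_expand_iff] at hC hA hB
  obtain ⟨hC, -, -⟩ := hC
  obtain ⟨hA, hA₁, hA₂⟩ := hA
  obtain ⟨hB, hB₁, hB₂⟩ := hB
  obtain ⟨D, i, j, hD, hun, hij, hint, hsuper⟩ :=
    hT.exists_union (reductEmbedding f) (reductEmbedding g) hA hB hC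
  choose K hKi hKj using fun p : Fin k => exists_op_union i.injective j.injective hun hij hint
    (opFun L p : A → A) (opFun L p : B → B) (opFun L p : C → C) (f.map_opFun p) (g.map_opFun p)
  have htrans : ∀ x y z : D, Structure.RelMap R ![x, y] → Structure.RelMap R ![y, z] →
      Structure.RelMap R ![x, z] :=
    (Relations.realize_transitive.1 (hR D hD)).trans
  have hcomm : ∀ (p q : Fin k) (d : D), K p (K q d) = K q (K p d) := by
    intro p q d
    rcases hun d with ⟨a, rfl⟩ | ⟨b, rfl⟩
    · simp only [← hKi]; rw [hA₂]
    · simp only [← hKj]; rw [hB₂]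
  have hi := i.relMap_pair R
  have hj := j.relMap_pair R
  have hholds : ∀ p, (kind p).Holds (fun x y : D => Structure.RelMap R ![x, y]) (K p) := by
    intro p
    refine OpKind.Holds.union hi hj hun (hKi p) (hKj p) (fun hmA hmB a b => ?_) (hA₁ p) (hB₁ p)
    replace hmA : ∀ x y : A, Structure.RelMap R ![i x, i y] →
        Structure.RelMap R ![i (opFun L p x), i (opFun L p y)] :=
      fun x y h => (hi _ _).2 (hmA x y ((hi x y).1 h))
    replace hmB : ∀ x y : B, Structure.RelMap R ![j x, j y] →
        Structure.RelMap R ![j (opFun L p x), j (opFun L p y)] :=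
      fun x y h => (hj _ _).2 (hmB x y ((hj x y).1 h))
    -- If `a` or `b` comes from `C`, the pair lies within one side, where isotonicity is given.
    by_cases ha : a ∈ Set.range f
    · obtain ⟨c, rfl⟩ := ha
      rw [← f.map_opFun, show i (f c) = j (g c) from hij c,
        show i (f (opFun L p c)) = j (g (opFun L p c)) from hij _, g.map_opFun]
      exact ⟨hmB _ _, hmB _ _⟩
    by_cases hb : b ∈ Set.range g
    · obtain ⟨c, rfl⟩ := hb
      rw [← g.map_opFun, show j (g c) = i (f c) from (hij c).symm,
        show j (g (opFun L p c)) = i (f (opFun L p c)) from (hij _).symm, f.map_opFun]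
      exact ⟨hmA _ _, hmA _ _⟩
    have hK : ∀ c : C, i (opFun L p (f c)) = j (opFun L p (g c)) := by
      intro c
      rw [← f.map_opFun, ← g.map_opFun]
      exact hij _
    refine ⟨fun h => ?_, fun h => ?_⟩
    -- Interpolate through `c`, apply the operation on each side, and rejoin at the common image of
    -- `c`.
    · obtain ⟨c, h₁, h₂⟩ := (hsuper a b ha hb).1 h
      have h₁' := hmA a (f c) ((hi _ _).2 h₁)
      have h₂' := hmB (g c) b ((hj _ _).2 h₂)
      rw [hK] at h₁'
      exact htrans _ _ _ h₁' h₂'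
    · obtain ⟨c, h₁, h₂⟩ := (hsuper a b ha hb).2 h
      have h₁' := hmB b (g c) ((hj _ _).2 h₁)
      have h₂' := hmA (f c) a ((hi _ _).2 h₂)
      rw [← hK] at h₁'
      exact htrans _ _ _ h₁' h₂'
  refine ⟨⟨D, expandStructure D.str K⟩, embeddingExpand K i hKi, embeddingExpand K j hKj,
    Theory.mem_models_expand_iff.2 ⟨hD, hholds, hcomm⟩, ?_⟩
  ext c
  exact hij c

end AmalgamationOfExpansions

end Expansion

end FirstOrder.Language

theorem corollary8p4 {L : FirstOrder.Language.{u, v}} [L.IsRelational]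
    [Finite L.Symbols] (R : L.Relations 2) (T : L.Theory) [T.IsUniversal]
    (hR : FirstOrder.Language.Theory.Entails.{u, v, max u v w} T R.transitive)
    (hT : FirstOrder.Language.Superamalgamation
      (FirstOrder.Language.Theory.models.{u, v, max u v w} T) R)
    (k : ℕ) (kind : Fin k → FirstOrder.Language.OpKind) :
    ∃ T' : (L.addOps k).Theory,
      FirstOrder.Language.Theory.IsModelCompletion.{u, v, max u v w} (T.expand R kind) T' :=
  ⟨_, FirstOrder.Language.Theory.isModelCompletion_richAxioms.{u, v, w}
    (FirstOrder.Language.determinesAtomic_expand T R kind)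
    (FirstOrder.Language.amalgamation_expand hR hT kind)⟩
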